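/- **Proposition 6.1.** Let $X_1,\dots,X_n$ be independent random variables with $\mathbb P\{X_j=1\}=p_j$ and $\mathbb P\{X_j=0\}=1-p_j$, $p_j\in[0,1]$, and let $W=X_1+\dots+X_n$. Put $\lambda=p_1+\dots+p_n$, $\lambda_2=p_1^2+\dots+p_n^2$, and let $Z$ be a Poisson random variable with parameter $\lambda$. Let $$D(W\|Z)=\sum_{k=0}^\infty \mathbb P\{W=k\}\,\log\frac{\mathbb P\{W=k\}}{\mathbb P\{Z=k\}}$$ be the relative entropy (terms with $\mathbb P\{W=k\}=0$ are understood as $0$; the series converges), and let $Q=\lambda/\max\{1,\lambda-\lambda_2\}$. If $\lambda_2\ge\kappa_0\lambda$ and $\lambda\ge\lambda_0$, where $\kappa_0=1-\exp\{-2\cdot10^7\}$ and $\lambda_0=\exp\{2\cdot10^7\}$, then $$D(W\|Z)\;\ge\;e^{-14}\,\log(eQ).$$ -/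

import Mathlib

/-- The relative entropy (Kullback-Leibler distance) `D(W‖Z) = ∑ₖ wₖ log (wₖ / vₖ)` of two random
variables with values in `ℕ`, where `wₖ = P{W = k}` and `vₖ = P'{Z = k}`. Terms with `wₖ = 0`
contribute `0`, as usual. -/
noncomputable def relEntropy {Ω Ω' : Type*} [MeasurableSpace Ω] [MeasurableSpace Ω']
    (P : MeasureTheory.Measure Ω) (W : Ω → ℕ) (P' : MeasureTheory.Measure Ω') (Z : Ω' → ℕ) : ℝ :=
  ∑' k : ℕ, P.real {ω | W ω = k} * Real.log (P.real {ω | W ω = k} / P'.real {ω | Z ω = k})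

/-- `λ = p₁ + ⋯ + pₙ`. -/
noncomputable def lam {n : ℕ} (p : Fin n → ℝ) : ℝ := ∑ j, p j

/-- `λ₂ = p₁² + ⋯ + pₙ²`. -/
noncomputable def lamTwo {n : ℕ} (p : Fin n → ℝ) : ℝ := ∑ j, p j ^ 2

/-- `Q = λ / max {1, λ - λ₂}`. -/
noncomputable def ratioQ {n : ℕ} (p : Fin n → ℝ) : ℝ := lam p / max 1 (lam p - lamTwo p)

/-!
The sum `W` has mean `λ` and variance `λ - λ₂`, which is tiny compared with the variance `λ` of the
Poisson variable `Z`. Put `s ^ 2 = max 1 (λ - λ₂)`, so that `Q = λ / s ^ 2`. By Chebyshev's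
inequality (`bernoulli_sum_chebyshev`) the window `A = [λ - 2 s, λ + 2 s]` carries mass at least
`3 / 4` of the law of `W`. It contains at most `5 s` integers, and by Stirling's formula
(`poissonMeasure_real_singleton_le`) each has Poisson probability at most `1 / √λ`, so that
`P(Z ∈ A) ≤ 5 s / √λ = 5 / √Q`.

Comparing the two masses of `A` (`sum_mul_log_div_ge`, with `a = √Q`) gives
`D(W‖Z) ≥ 3 / 8 * log Q - 5` (`poisson_relEntropy_ge`). The hypotheses give `log Q ≥ 2e7`, so this
exceeds `exp (-14) * log (e Q)`. The series converges because `W ≤ n` almost surely, so that only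
finitely many terms are nonzero.
-/

open MeasureTheory ProbabilityTheory Finset

/-! ### Relative entropy on finite sets -/

/-- The elementary bound `log x ≥ 1 - 1 / x` at `x = w / (c v)`. -/
lemma mul_log_div_ge {w v c : ℝ} (hw : 0 ≤ w) (hv : 0 < v) (hc : 0 < c) :
    w * Real.log c + w - c * v ≤ w * Real.log (w / v) := by
  rcases hw.eq_or_lt with rfl | hw
  · simp; positivity
  · have h := Real.one_sub_inv_le_log_of_pos (x := w / v / c) (by positivity)
    rw [Real.log_div (by positivity) (by positivity)] at h
    have h2 := mul_le_mul_of_nonneg_left h hw.le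
    have h3 : w * (1 - (w / v / c)⁻¹) = w - c * v := by field_simp
    linarith

/-- A weak form of the data processing inequality for the partition `{A, S \ A}`. With `a` of the
order of the ratio `w(A) / v(A)` nothing essential is lost. -/
lemma sum_mul_log_div_ge {ι : Type*} [DecidableEq ι] {S A : Finset ι} (hA : A ⊆ S) {w v : ι → ℝ}
    (hw : ∀ k, 0 ≤ w k) (hv : ∀ k, 0 < v k) (hw1 : ∑ k ∈ S, w k = 1) (hv1 : ∑ k ∈ S, v k ≤ 1)
    {a : ℝ} (ha : 0 < a) :
    (∑ k ∈ A, w k) * Real.log a - a * ∑ k ∈ A, v k ≤ ∑ k ∈ S, w k * Real.log (w k / v k) := by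
  have h1 : ∑ k ∈ A, (w k * Real.log a + w k - a * v k) ≤ ∑ k ∈ A, w k * Real.log (w k / v k) :=
    sum_le_sum fun k _ ↦ mul_log_div_ge (hw k) (hv k) ha
  have h2 : ∑ k ∈ S \ A, (w k - v k) ≤ ∑ k ∈ S \ A, w k * Real.log (w k / v k) :=
    sum_le_sum fun k _ ↦ by simpa using mul_log_div_ge (hw k) (hv k) one_pos
  rw [sum_sub_distrib, sum_add_distrib, ← sum_mul, ← mul_sum] at h1
  rw [sum_sub_distrib] at h2
  rw [← sum_sdiff hA] at hw1 hv1 ⊢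
  have h3 : 0 ≤ ∑ k ∈ A, v k := sum_nonneg fun k _ ↦ (hv k).le
  linarith

/-! ### Poisson point probabilities -/

/-- The Poisson weights are at most of the order `1 / √k`: Stirling's lower bound for `k!` leaves
the factor `exp (k - r) * (r / k) ^ k ≤ 1`. -/
lemma poissonMeasure_real_singleton_le (r : NNReal) {k : ℕ} (hk : k ≠ 0) :
    (poissonMeasure r).real {k} ≤ 1 / √(2 * Real.pi * k) := by
  have hk0 : (0 : ℝ) < k := by positivity
  rw [poissonMeasure_real_singleton, div_le_div_iff₀ (by positivity) (by positivity), one_mul]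
  refine le_trans ?_ (Stirling.le_factorial_stirling k)
  rw [mul_comm]
  refine mul_le_mul_of_nonneg_left ?_ (by positivity)
  have h1 : (r : ℝ) / k ≤ Real.exp (r / k - 1) := by
    linarith [Real.add_one_le_exp ((r : ℝ) / k - 1)]
  have h2 := pow_le_pow_left₀ (by positivity) h1 k
  rw [← Real.exp_nat_mul, show (k : ℝ) * (r / k - 1) = r - k by field_simp, div_pow,
    div_le_iff₀ (by positivity)] at h2
  calc Real.exp (-r) * (r : ℝ) ^ k ≤ Real.exp (-r) * (Real.exp (r - k) * k ^ k) := by gcongr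
    _ = (k / Real.exp 1) ^ k := by
      rw [div_pow, ← Real.exp_nat_mul, ← mul_assoc, ← Real.exp_add, mul_one, div_eq_mul_inv,
        ← Real.exp_neg, mul_comm]
      congr 2
      ring

/-! ### Sums of independent Bernoulli variables -/

section Bernoulli

variable {Ω : Type*} [MeasurableSpace Ω] {P : Measure Ω}

lemma integral_bernoulli {X : Ω → ℕ} {p : ℝ} (hX : AEMeasurable X P)
    (h : ∀ᵐ ω ∂P, X ω = 0 ∨ X ω = 1) (h1 : P.real {ω | X ω = 1} = p) :
    ∫ ω, (X ω : ℝ) ∂P = p := by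
  have hm : NullMeasurableSet {ω | X ω = 1} P :=
    hX.nullMeasurableSet_preimage (measurableSet_singleton 1)
  have hint : ∫ ω, {ω | X ω = 1}.indicator (fun _ ↦ (1 : ℝ)) ω ∂P = p := by
    rw [integral_indicator₀ hm, ← h1]; simp
  rw [← hint]
  refine integral_congr_ae ?_
  filter_upwards [h] with ω hω
  rcases hω with hω | hω <;> simp [Set.indicator, hω]

variable [IsProbabilityMeasure P]

lemma ae_eq_zero_or_one {X : Ω → ℕ} {p : ℝ} (hX : AEMeasurable X P)
    (h1 : P.real {ω | X ω = 1} = p) (h0 : P.real {ω | X ω = 0} = 1 - p) :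
    ∀ᵐ ω ∂P, X ω = 0 ∨ X ω = 1 := by
  have hm (k : ℕ) : NullMeasurableSet {ω | X ω = k} P :=
    hX.nullMeasurableSet_preimage (measurableSet_singleton k)
  have hd : Disjoint {ω | X ω = 0} {ω | X ω = 1} := by
    rw [Set.disjoint_left]; intro ω; simp; omega
  refine (mem_ae_iff_prob_eq_one₀ ((hm 0).union (hm 1))).2 ?_
  have h := measureReal_union₀ (hm 1) hd.aedisjoint
  rw [h0, h1, sub_add_cancel, measureReal_def, ENNReal.toReal_eq_one_iff] at h
  exact h

lemma memLp_bernoulli {X : Ω → ℕ} (hX : AEMeasurable X P) (h : ∀ᵐ ω ∂P, X ω = 0 ∨ X ω = 1) :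
    MemLp (fun ω ↦ (X ω : ℝ)) 2 P := by
  refine MemLp.of_bound (AEMeasurable.aestronglyMeasurable (by fun_prop)) 1 ?_
  filter_upwards [h] with ω hω
  rcases hω with hω | hω <;> simp [hω]

lemma variance_bernoulli {X : Ω → ℕ} {p : ℝ} (hX : AEMeasurable X P)
    (h : ∀ᵐ ω ∂P, X ω = 0 ∨ X ω = 1) (h1 : P.real {ω | X ω = 1} = p) :
    variance (fun ω ↦ (X ω : ℝ)) P = p - p ^ 2 := by
  rw [variance_eq_sub (memLp_bernoulli hX h), integral_bernoulli hX h h1]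
  congr 1
  rw [← integral_bernoulli hX h h1]
  refine integral_congr_ae ?_
  filter_upwards [h] with ω hω
  rcases hω with hω | hω <;> simp [hω]

/-- Chebyshev's inequality for `W = ∑ j, X j`, whose mean is `λ` and whose variance is
`λ - λ₂`. -/
lemma bernoulli_sum_chebyshev {n : ℕ} {p : Fin n → ℝ} {X : Fin n → Ω → ℕ}
    (hX : ∀ j, AEMeasurable (X j) P) (hindep : iIndepFun X P)
    (h01 : ∀ j, ∀ᵐ ω ∂P, X j ω = 0 ∨ X j ω = 1) (h1 : ∀ j, P.real {ω | X j ω = 1} = p j)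
    {c : ℝ} (hc : 0 < c) :
    P.real {ω | c ≤ |((∑ j, X j ω : ℕ) : ℝ) - lam p|} ≤ (lam p - lamTwo p) / c ^ 2 := by
  let Y : Fin n → Ω → ℝ := fun j ω ↦ (X j ω : ℝ)
  have hY (j) : MemLp (Y j) 2 P := memLp_bernoulli (hX j) (h01 j)
  have hYi : iIndepFun Y P := hindep.comp (fun _ k ↦ (k : ℝ)) fun _ ↦ by fun_prop
  have hsum : MemLp (∑ j, Y j) 2 P := memLp_finsetSum' _ fun j _ ↦ hY j
  have hmean : ∫ ω, (∑ j, Y j) ω ∂P = lam p := by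
    simp only [Finset.sum_apply]
    rw [integral_finsetSum _ fun j _ ↦ (hY j).integrable one_le_two]
    exact sum_congr rfl fun j _ ↦ integral_bernoulli (hX j) (h01 j) (h1 j)
  have hvar : variance (∑ j, Y j) P = lam p - lamTwo p := by
    rw [IndepFun.variance_sum (fun j _ ↦ hY j) fun i _ j _ hij ↦ hYi.indepFun hij, lam, lamTwo,
      ← sum_sub_distrib]
    exact sum_congr rfl fun j _ ↦ variance_bernoulli (hX j) (h01 j) (h1 j)
  have h := meas_ge_le_variance_div_sq hsum hc
  rw [hmean, hvar] at h
  have h0 : 0 ≤ (lam p - lamTwo p) / c ^ 2 := by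
    rw [← hvar]; exact div_nonneg (variance_nonneg _ _) (sq_nonneg c)
  have h2 := ENNReal.toReal_le_of_le_ofReal h0 h
  simpa [Y, measureReal_def] using h2

end Bernoulli

/-! ### The window of concentration -/

/-- The integers in `[x - 2 s, x + 2 s]`. -/
noncomputable def window (x s : ℝ) : Finset ℕ := Icc ⌈x - 2 * s⌉₊ ⌊x + 2 * s⌋₊

lemma le_abs_of_notMem_window {x s : ℝ} (h : 0 ≤ x + 2 * s) {k : ℕ} (hk : k ∉ window x s) :
    2 * s ≤ |(k : ℝ) - x| := by
  by_contra! hlt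
  rw [abs_lt] at hlt
  exact hk (mem_Icc.2 ⟨Nat.ceil_le.2 (by linarith), (Nat.le_floor_iff h).2 (by linarith)⟩)

lemma card_window_le {x s : ℝ} (hs : 1 ≤ s) (hx : 0 ≤ x) : ((window x s).card : ℝ) ≤ 5 * s := by
  rw [window, Nat.card_Icc]
  rcases le_total ⌈x - 2 * s⌉₊ (⌊x + 2 * s⌋₊ + 1) with h | h
  · rw [Nat.cast_sub h]
    push_cast
    linarith [Nat.le_ceil (x - 2 * s), Nat.floor_le (show 0 ≤ x + 2 * s by linarith)]
  · rw [Nat.sub_eq_zero_of_le h]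
    push_cast
    linarith

/-- On the window, Poisson weights are at most `1 / √r`, as its points are at least `r / 2`. -/
lemma poissonMeasure_real_window_le {r : NNReal} {s : ℝ} (hr : 0 < r) (hs : 1 ≤ s)
    (hsr : 4 * s ≤ r) : ∑ k ∈ window r s, (poissonMeasure r).real {k} ≤ 5 * s / √r := by
  have hr' : (0 : ℝ) < r := hr
  have hk (k) (hk : k ∈ window r s) : (poissonMeasure r).real {k} ≤ 1 / √r := by
    have h1 : (r : ℝ) - 2 * s ≤ k := Nat.ceil_le.1 (mem_Icc.1 hk).1
    have h0 : (0 : ℝ) < k := by linarith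
    refine (poissonMeasure_real_singleton_le r (by exact_mod_cast h0.ne')).trans ?_
    refine one_div_le_one_div_of_le (by positivity) (Real.sqrt_le_sqrt ?_)
    nlinarith [Real.pi_gt_three]
  calc ∑ k ∈ window r s, (poissonMeasure r).real {k}
      ≤ (window r s).card • (1 / √r : ℝ) := sum_le_card_nsmul _ _ _ hk
    _ ≤ 5 * s * (1 / √r) := by
      rw [nsmul_eq_mul]
      exact mul_le_mul_of_nonneg_right (card_window_le hs hr'.le) (by positivity)
    _ = 5 * s / √r := by ring

/-! ### The lower bound -/

/-- If a law `μ` on a finite subset of `ℕ` gives mass at least `3 / 4` to the window of width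
`s` around `r`, its relative entropy with respect to the Poisson law with parameter `r` is at least
`3 / 8 * log (r / s ^ 2) - 5`. -/
lemma poisson_relEntropy_ge (μ : Measure ℕ) [IsProbabilityMeasure μ] {r : NNReal} {s : ℝ} {n : ℕ}
    (hr : 0 < r) (hs : 1 ≤ s) (hsr : 4 * s ≤ r) (hsr2 : s ^ 2 ≤ r)
    (hn : ∀ k, n < k → μ.real {k} = 0) (hμ : 3 / 4 ≤ μ.real (window r s)) :
    Summable (fun k ↦ μ.real {k} * Real.log (μ.real {k} / (poissonMeasure r).real {k})) ∧
      3 / 8 * Real.log (r / s ^ 2) - 5 ≤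
        ∑' k, μ.real {k} * Real.log (μ.real {k} / (poissonMeasure r).real {k}) := by
  have hr' : (0 : ℝ) < r := hr
  set S := range (n + 1) ∪ window r s
  have hS {k} (hk : k ∉ S) : μ.real {k} = 0 := hn k <| by
    by_contra! h
    exact hk (mem_union_left _ (mem_range.2 (by omega)))
  refine ⟨summable_of_ne_finset_zero (s := S) fun k hk ↦ by simp [hS hk], ?_⟩
  rw [tsum_eq_sum (s := S) fun k hk ↦ by simp [hS hk]]
  have hw1 : ∑ k ∈ S, μ.real {k} = 1 := by
    rw [sum_measureReal_singleton, measureReal_def, ENNReal.toReal_eq_one_iff,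
      ← prob_compl_eq_zero_iff S.measurableSet]
    refine (measure_null_iff_singleton (Set.to_countable _)).2 fun k hk ↦ ?_
    exact (measureReal_eq_zero_iff).1 (hS (by simpa using hk))
  have hv1 : ∑ k ∈ S, (poissonMeasure r).real {k} ≤ 1 := by
    rw [sum_measureReal_singleton]; exact measureReal_le_one
  have ha : (0 : ℝ) < √r / s := by positivity
  have h := sum_mul_log_div_ge (subset_union_right : window r s ⊆ S)
    (fun k ↦ measureReal_nonneg (μ := μ) (s := {k}))
    (fun k ↦ poissonMeasure_real_singleton_pos k hr) hw1 hv1 ha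
  refine le_trans ?_ h
  have hlog : Real.log (√r / s) = Real.log (r / s ^ 2) / 2 := by
    rw [← Real.log_sqrt (by positivity), Real.sqrt_div hr'.le, Real.sqrt_sq (by linarith)]
  have hlog0 : 0 ≤ Real.log (r / s ^ 2) :=
    Real.log_nonneg ((one_le_div (by positivity)).2 hsr2)
  have hV : √r / s * ∑ k ∈ window r s, (poissonMeasure r).real {k} ≤ 5 := by
    calc _ ≤ √r / s * (5 * s / √r) := by gcongr; exact poissonMeasure_real_window_le hr hs hsr
      _ = 5 := by field_simp
  rw [hlog, sum_measureReal_singleton]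
  nlinarith

theorem proposition6p1
    {Ω Ω' : Type*} [MeasurableSpace Ω] [MeasurableSpace Ω']
    (P : MeasureTheory.Measure Ω) [MeasureTheory.IsProbabilityMeasure P]
    (P' : MeasureTheory.Measure Ω') [MeasureTheory.IsProbabilityMeasure P']
    (n : ℕ) (p : Fin n → ℝ)
    -- independent random variables with `P{X_j = 1} = p_j` and `P{X_j = 0} = 1 - p_j`
    (X : Fin n → Ω → ℕ)
    (hXmeas : ∀ j, AEMeasurable (X j) P)
    (hXindep : ProbabilityTheory.iIndepFun X P)
    (hXone : ∀ j, P.real {ω | X j ω = 1} = p j)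
    (hXzero : ∀ j, P.real {ω | X j ω = 0} = 1 - p j)
    -- a Poisson random variable with parameter `λ`
    (Z : Ω' → ℕ)
    (hZ : ProbabilityTheory.HasLaw Z (ProbabilityTheory.poissonMeasure (lam p).toNNReal) P')
    (hdeg : (1 - Real.exp (-(2 * 10 ^ 7))) * lam p ≤ lamTwo p)
    (hlam : Real.exp (2 * 10 ^ 7) ≤ lam p) :
    -- the series that defines `D(W‖Z)` converges, and the lower bound holds
    Summable (fun k : ℕ => P.real {ω | ∑ j, X j ω = k} *
        Real.log (P.real {ω | ∑ j, X j ω = k} / P'.real {ω | Z ω = k})) ∧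
      Real.exp (-14) * Real.log (Real.exp 1 * ratioQ p) ≤
        relEntropy P (fun ω => ∑ j, X j ω) P' Z := by
  have hL1 : 20000001 ≤ lam p := by
    linarith [Real.add_one_le_exp ((2 : ℝ) * 10 ^ 7)]
  have hL0 : 0 < lam p := by linarith
  have hr : ((lam p).toNNReal : ℝ) = lam p := Real.coe_toNNReal _ hL0.le
  -- the scale of concentration: `s ^ 2 = max 1 (λ - λ₂)`, at most `exp (-2e7) * λ`
  have hm1 : 1 ≤ max 1 (lam p - lamTwo p) := le_max_left _ _
  set s := √(max 1 (lam p - lamTwo p))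
  have hs2 : s ^ 2 = max 1 (lam p - lamTwo p) := Real.sq_sqrt (by linarith)
  have hs : 1 ≤ s := Real.one_le_sqrt.2 hm1
  have hexp : Real.exp (2 * 10 ^ 7) * s ^ 2 ≤ lam p := by
    rw [hs2, mul_max_of_nonneg _ _ (Real.exp_pos _).le]
    refine max_le (by linarith) ?_
    have h1 : lam p - lamTwo p ≤ Real.exp (-(2 * 10 ^ 7)) * lam p := by linarith
    have h2 := mul_le_mul_of_nonneg_left h1 (Real.exp_pos (2 * 10 ^ 7)).le
    rwa [← mul_assoc, ← Real.exp_add, add_neg_cancel, Real.exp_zero, one_mul] at h2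
  have hlogQ : 2 * 10 ^ 7 ≤ Real.log (lam p / s ^ 2) := by
    rw [Real.le_log_iff_exp_le (by positivity), le_div_iff₀ (by positivity)]
    exact hexp
  have hs_small : 16 * s ^ 2 ≤ lam p :=
    (mul_le_mul_of_nonneg_right (by linarith [Real.add_one_le_exp ((2 : ℝ) * 10 ^ 7)])
      (sq_nonneg s)).trans hexp
  -- the law of `W`
  have h01 (j) := ae_eq_zero_or_one (hXmeas j) (hXone j) (hXzero j)
  have hW : AEMeasurable (fun ω ↦ ∑ j, X j ω) P := by fun_prop
  have : IsProbabilityMeasure (P.map fun ω ↦ ∑ j, X j ω) := Measure.isProbabilityMeasure_map hW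
  have hmap (k : ℕ) : (P.map fun ω ↦ ∑ j, X j ω).real {k} = P.real {ω | ∑ j, X j ω = k} := by
    rw [map_measureReal_apply_of_aemeasurable hW (measurableSet_singleton k)]; rfl
  have hpoi (k : ℕ) : (poissonMeasure (lam p).toNNReal).real {k} = P'.real {ω | Z ω = k} := by
    rw [← hZ.map_eq, map_measureReal_apply_of_aemeasurable hZ.aemeasurable
      (measurableSet_singleton k)]; rfl
  have hn (k : ℕ) (hk : n < k) : (P.map fun ω ↦ ∑ j, X j ω).real {k} = 0 := by
    have h : ∀ᵐ ω ∂P, ¬ ∑ j, X j ω = k := by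
      filter_upwards [ae_all_iff.2 h01] with ω hω
      have : ∑ j, X j ω ≤ ∑ _j : Fin n, 1 := sum_le_sum fun j _ ↦ by have := hω j; omega
      simp at this
      omega
    rw [hmap, measureReal_def, show P {ω | ∑ j, X j ω = k} = 0 by simpa [ae_iff] using h]
    rfl
  have hwin : 3 / 4 ≤ (P.map fun ω ↦ ∑ j, X j ω).real (window (lam p).toNNReal s) := by
    have hch := bernoulli_sum_chebyshev hXmeas hXindep h01 hXone (c := 2 * s) (by linarith)
    have hq : (lam p - lamTwo p) / (2 * s) ^ 2 ≤ 1 / 4 := by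
      rw [div_le_iff₀ (by positivity), mul_pow, hs2]
      linarith [le_max_right 1 (lam p - lamTwo p)]
    have hc : (P.map fun ω ↦ ∑ j, X j ω).real (window (lam p).toNNReal s : Set ℕ)ᶜ ≤ 1 / 4 := by
      rw [map_measureReal_apply_of_aemeasurable hW (Finset.measurableSet _).compl]
      refine (measureReal_mono fun ω hω ↦ ?_).trans (hch.trans hq)
      have := le_abs_of_notMem_window (x := ((lam p).toNNReal : ℝ)) (s := s)
        (by rw [hr]; linarith) (k := ∑ j, X j ω) (by simpa using hω)
      rwa [hr] at this
    have := probReal_add_probReal_compl (μ := P.map fun ω ↦ ∑ j, X j ω)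
      (window (lam p).toNNReal s).measurableSet
    linarith
  obtain ⟨hsum, hD⟩ := poisson_relEntropy_ge (P.map fun ω ↦ ∑ j, X j ω)
    (r := (lam p).toNNReal) (s := s) (Real.toNNReal_pos.2 hL0) hs (by rw [hr]; nlinarith)
    (by rw [hr]; nlinarith) hn hwin
  simp only [hmap, hpoi, hr] at hsum hD
  refine ⟨hsum, le_trans ?_ hD⟩
  have hQ : 0 < ratioQ p := div_pos hL0 (by linarith)
  rw [Real.log_mul (Real.exp_pos 1).ne' hQ.ne', Real.log_exp, ratioQ, ← hs2]
  -- `exp (-14) ≤ 1 / 15` is enough, as the logarithm is at least `2e7`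
  have he : Real.exp (-14) ≤ 1 / 15 := by
    rw [Real.exp_neg, ← one_div]
    exact one_div_le_one_div_of_le (by norm_num) (by linarith [Real.add_one_le_exp (14 : ℝ)])
  have := mul_le_mul_of_nonneg_right he (show 0 ≤ 1 + Real.log (lam p / s ^ 2) by linarith)
  linarith
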